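/- Let $n \ge 2$ and let $G = D_n = \langle \sigma, \tau : \sigma^n = \tau^2 = 1,\ \tau\sigma\tau^{-1} = \sigma^{-1}\rangle$ be the dihedral group of order $2n$. Let $1 \to R \to F \xrightarrow{\varepsilon} G \to 1$ be a free presentation of $G$, where $F$ is a free group of finite rank, $\varepsilon$ is surjective and $R = \ker \varepsilon$. The abelian group $R^{ab} = R/[R,R]$ is a $G$-module, where for $f \in F$ and $r \in R$ the element $\varepsilon(f)$ sends the class of $r$ to the class of $f r f^{-1}$. Recall that a $G$-lattice is a $\mathbb{Z}[G]$-module that is finitely generated and torsion-free as an abelian group; a permutation lattice is a $G$-lattice with a $\mathbb{Z}$-basis permuted by $G$; an invertible lattice is a direct summand of a permutation lattice; and a $G$-lattice $M$ is flabby (respectively coflabby) if the Tate cohomology group $H^{-1}(S, M)$ (respectively $H^{1}(S, M)$) vanishes for every subgroup $S$ of $G$. Then $R^{ab}$ is a $G$-lattice, and: 1. if $n$ is odd, then $R^{ab}$ is an invertible lattice; 2. if $n$ is even, then $R^{ab}$ is coflabby, but is not flabby. -/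

import Mathlib

namespace GLattice

/-- A `G`-lattice is a `ℤ[G]`-module that is finitely generated and torsion-free as an abelian
group. `ℤ[G]`-modules are Mathlib's `Rep ℤ G`. -/
structure IsLattice {G : Type} [Group G] (M : Rep.{0} ℤ G) : Prop where
  finite : Module.Finite ℤ M
  torsionFree : IsAddTorsionFree M

/-- A permutation lattice: it has a finite `ℤ`-basis that is permuted by `G`. (Each `g` acts
injectively, so it is enough that it maps the basis into itself.) -/
def IsPermutation {G : Type} [Group G] (P : Rep.{0} ℤ G) : Prop :=
  ∃ (k : ℕ) (b : @Module.Basis (Fin k) ℤ P _ _ P.hV2), ∀ (g : G) (i : Fin k), ∃ j : Fin k, P.ρ g (b i) = b j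

/-- An invertible lattice: a direct summand of some permutation lattice. -/
def IsInvertible {G : Type} [Group G] (M : Rep.{0} ℤ G) : Prop :=
  ∃ P N : Rep.{0} ℤ G, IsPermutation P ∧ Nonempty (CategoryTheory.Limits.biprod M N ≅ P)

/-- The vanishing of the Tate cohomology groups `H^{-1}(S, M)` for all subgroups `S` of `G`. A lattice
with this property is called flabby. -/
def IsFlabby {G : Type} [Group G] [Finite G] (M : Rep.{0} ℤ G) : Prop :=
  ∀ (S : Subgroup G) [Fintype S], Subsingleton (tateCohomology (Rep.res S.subtype M) (-1))

/-- The vanishing of the Tate cohomology groups `H^1(S, M)` for all subgroups `S` of `G`. A lattice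
with this property is called coflabby. -/
def IsCoflabby {G : Type} [Group G] [Finite G] (M : Rep.{0} ℤ G) : Prop :=
  ∀ (S : Subgroup G) [Fintype S], Subsingleton (tateCohomology (Rep.res S.subtype M) 1)

end GLattice

namespace RelationModule

/-- The action of `F` on `Nᵃᵇ` induced by conjugation on the normal subgroup `N`. -/
def conjRep {F : Type} [Group F] (N : Subgroup F) [N.Normal] :
    Representation ℤ F (Additive (Abelianization N)) where
  toFun f :=
    (MonoidHom.toAdditive (Abelianization.map (MulAut.conjNormal f).toMonoidHom)).toIntLinearMap
  map_one' := by
    ext x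
    induction x using Additive.rec with | ofMul x => ?_
    induction x using QuotientGroup.induction_on with | H x => ?_
    exact congrArg (fun y => Additive.ofMul (Abelianization.of y)) (by ext; simp)
  map_mul' f g := by
    ext x
    induction x using Additive.rec with | ofMul x => ?_
    induction x using QuotientGroup.induction_on with | H x => ?_
    exact congrArg (fun y => Additive.ofMul (Abelianization.of y)) (by ext; simp [mul_assoc])

theorem conjRep_apply {F : Type} [Group F] (N : Subgroup F) [N.Normal] (f : F) (r : N) :
    conjRep N f (Additive.ofMul (Abelianization.of r)) =
      Additive.ofMul (Abelianization.of (MulAut.conjNormal f r)) :=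
  rfl

theorem conjRep_of_mem {F : Type} [Group F] (N : Subgroup F) [N.Normal] (f : F) (hf : f ∈ N) :
    conjRep N f = 1 := by
  ext x
  induction x using Additive.rec with | ofMul x => ?_
  induction x using QuotientGroup.induction_on with | H x => ?_
  change Additive.ofMul (Abelianization.of (MulAut.conjNormal f x)) =
    Additive.ofMul (Abelianization.of x)
  have h : MulAut.conjNormal f x = (⟨f, hf⟩ : N) * x * (⟨f, hf⟩ : N)⁻¹ := by ext; simp
  refine congrArg Additive.ofMul ?_
  rw [h, map_mul, map_mul, map_inv, mul_inv_cancel_comm]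

/-- The action of `G` on `Rᵃᵇ`, where `R` is the kernel of the surjection `ε : F → G`: the element
`ε f` acts as conjugation by `f`. -/
noncomputable def rep {F G : Type} [Group F] [Group G] (ε : F →* G)
    (hε : Function.Surjective ε) : Representation ℤ G (Additive (Abelianization ε.ker)) :=
  (QuotientGroup.lift ε.ker (conjRep ε.ker) (fun f hf => conjRep_of_mem ε.ker f hf)).comp
    (QuotientGroup.quotientKerEquivOfSurjective ε hε).symm.toMonoidHom

theorem rep_apply {F G : Type} [Group F] [Group G] (ε : F →* G)
    (hε : Function.Surjective ε) (f : F) (r : ε.ker) :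
    rep ε hε (ε f) (Additive.ofMul (Abelianization.of r)) =
      Additive.ofMul (Abelianization.of (MulAut.conjNormal f r)) := by
  have h : (QuotientGroup.quotientKerEquivOfSurjective ε hε).symm (ε f) = (f : F ⧸ ε.ker) := by
    rw [MulEquiv.symm_apply_eq]; rfl
  simp only [rep, MonoidHom.comp_apply, MulEquiv.toMonoidHom_eq_coe, MonoidHom.coe_coe, h]
  rfl

end RelationModule

/-- The relation module `Rᵃᵇ = R / [R, R]`, `R = ker ε`, of the presentation `ε : F → G`, with `G`
acting through conjugation in `F`. -/
noncomputable def relationModule {F G : Type} [Group F] [Group G] (ε : F →* G)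
    (hε : Function.Surjective ε) : Rep.{0} ℤ G :=
  Rep.of (RelationModule.rep ε hε)

namespace GLattice

/-- The representation of `G` on the functions on a `G`-set with values in the ground ring. -/
def funRep (k G X : Type) [CommRing k] [Group G] [MulAction G X] : Representation k G (X → k) where
  toFun g := LinearMap.funLeft k k (fun x => g⁻¹ • x)
  map_one' := by ext; simp [LinearMap.funLeft]
  map_mul' g h := by ext; simp [LinearMap.funLeft, mul_smul]

theorem funRep_apply {k G X : Type} [CommRing k] [Group G] [MulAction G X] (g : G) (v : X → k)
    (x : X) : funRep k G X g v x = v (g⁻¹ • x) := rfl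

theorem funRep_single {k G X : Type} [CommRing k] [Group G] [MulAction G X] [DecidableEq X] (g : G)
    (x : X) (a : k) : funRep k G X g (Pi.single x a) = Pi.single (g • x) a := by
  ext y
  simp only [funRep_apply, Pi.single_apply, inv_smul_eq_iff]

/-- A representation is a direct summand of a permutation representation as soon as it has a system
of elements and functionals, indexed by a finite `G`-set, that behaves like a dual basis. -/
theorem exists_biprod_iso_of_dualSystem {k G X : Type} [CommRing k] [Group G] [MulAction G X]
    [Fintype X] (M : Rep.{0} k G) (f : X → M) (hf : ∀ (g : G) x, f (g • x) = M.ρ g (f x))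
    (α : X → M →ₗ[k] k) (hα : ∀ (g : G) x m, α (g • x) (M.ρ g m) = α x m)
    (h : ∀ m, ∑ x, α x m • f x = m) : ∃ N : Rep.{0} k G,
      Nonempty (CategoryTheory.Limits.biprod M N ≅ Rep.of (funRep k G X)) := by
  let P : Rep.{0} k G := Rep.of (funRep k G X)
  let i : M ⟶ P := Rep.ofHom
    { LinearMap.pi α with
      isIntertwining' := fun g => by
        ext m x
        change α x (M.ρ g m) = α (g⁻¹ • x) m
        rw [← hα g (g⁻¹ • x), smul_inv_smul] }
  let p : P ⟶ M := Rep.ofHom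
    { Fintype.linearCombination k f with
      isIntertwining' := fun g => by
        refine LinearMap.ext fun v => ?_
        change ∑ x, v (g⁻¹ • x) • f x = M.ρ g (∑ x, v x • f x)
        rw [map_sum, ← Equiv.sum_comp (MulAction.toPerm g) (fun x => v (g⁻¹ • x) • f x)]
        simp [hf] }
  have hip : CategoryTheory.CategoryStruct.comp i p = CategoryTheory.CategoryStruct.id M := by
    ext m
    exact h m
  have : CategoryTheory.IsSplitMono i := ⟨⟨⟨p, hip⟩⟩⟩
  let S : CategoryTheory.ShortComplex (Rep.{0} k G) :=
    CategoryTheory.ShortComplex.mk i (CategoryTheory.Limits.cokernel.π i) (by simp)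
  have hS : S.Exact := CategoryTheory.ShortComplex.exact_cokernel i
  have : CategoryTheory.Epi S.g := inferInstanceAs
    (CategoryTheory.Epi (CategoryTheory.Limits.cokernel.π i))
  exact ⟨CategoryTheory.Limits.cokernel i,
    ⟨(CategoryTheory.ShortComplex.Splitting.ofExactOfRetraction S hS p hip
      inferInstance).isoBinaryBiproduct.symm⟩⟩

theorem isPermutation_funRep {G X : Type} [Group G] [MulAction G X] [Fintype X] :
    IsPermutation (Rep.of (funRep ℤ G X)) := by
  classical
  refine ⟨Fintype.card X, (Pi.basisFun ℤ X).reindex (Fintype.equivFin X), fun g j =>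
      ⟨Fintype.equivFin X (g • (Fintype.equivFin X).symm j), ?_⟩⟩
  simp only [Module.Basis.reindex_apply, Pi.basisFun_apply, Equiv.symm_apply_apply]
  exact funRep_single g _ 1

theorem isInvertible_of_dualSystem {G X : Type} [Group G] [MulAction G X] [Fintype X]
    (M : Rep.{0} ℤ G) (f : X → M) (hf : ∀ (g : G) x, f (g • x) = M.ρ g (f x))
    (α : X → M →+ ℤ) (hα : ∀ (g : G) x m, α (g • x) (M.ρ g m) = α x m)
    (h : ∀ m, ∑ x, α x m • f x = m) : IsInvertible M := by
  let β : ∀ x, @LinearMap ℤ ℤ _ _ (RingHom.id ℤ) M ℤ _ _ M.hV2 _ := fun x =>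
    @LinearMap.mk ℤ ℤ _ _ (RingHom.id ℤ) M ℤ _ _ M.hV2 _ (α x).toAddHom fun k m =>
      (congrArg (α x) (int_smul_eq_zsmul _ k m)).trans (map_zsmul (α x) k m)
  obtain ⟨N, hN⟩ := exists_biprod_iso_of_dualSystem M f hf β hα fun m => by
    refine Eq.trans (Finset.sum_congr rfl fun x _ => ?_) (h m)
    exact int_smul_eq_zsmul _ _ _
  exact ⟨_, N, isPermutation_funRep, hN⟩

theorem exists_d₁₀_eq_of_norm_eq_zero {k G : Type} [CommRing k] [Group G] [Fintype G]
    (M : Rep.{0} k G) (h : Subsingleton (tateCohomology M (-1))) (m : M)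
    (hm : ∑ g : G, M.ρ g m = 0) : ∃ z : G →₀ M, groupHomology.d₁₀ M z = m := by
  change Subsingleton ((tateComplex M).homology (-1)) at h
  have hz : CategoryTheory.Limits.IsZero ((tateComplex M).homology (-1)) :=
    ModuleCat.isZero_of_subsingleton _
  rw [← HomologicalComplex.exactAt_iff_isZero_homology,
    HomologicalComplex.exactAt_iff' _ (-2) (-1) 0 (by simp) (by simp),
    CategoryTheory.ShortComplex.moduleCat_exact_iff] at hz
  have hm0 : M.ρ.norm m = 0 := by rw [Representation.norm, LinearMap.sum_apply, hm]
  obtain ⟨y, hy⟩ := hz ((groupHomology.chainsIso₀ M).inv m) (by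
    change Rep.tateNorm M ((groupHomology.chainsIso₀ M).inv m) = 0
    rw [Rep.tateNorm, ModuleCat.comp_apply, ModuleCat.comp_apply,
      CategoryTheory.Iso.inv_hom_id_apply]
    exact (congrArg _ hm0).trans (map_zero _))
  let y' : (groupHomology.inhomogeneousChains M).X 1 := y
  replace hy : (groupHomology.inhomogeneousChains M).d 1 0 y' =
    (groupHomology.chainsIso₀ M).inv m := hy
  refine ⟨(groupHomology.chainsIso₁ M).hom y', ?_⟩
  have h2 := congrArg (groupHomology.chainsIso₀ M).hom hy
  rw [CategoryTheory.Iso.inv_hom_id_apply, ← ModuleCat.comp_apply, ← groupHomology.comp_d₁₀_eq,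
    ModuleCat.comp_apply] at h2
  exact h2

/-- An element of norm zero on which some invariant homomorphism does not vanish gives a nonzero
class in `H^{-1}(G, M)`. -/
theorem not_isFlabby_of_functional {G A : Type} [Group G] [Fintype G] [AddCommGroup A]
    (M : Rep.{0} ℤ G) (χ : M →+ A) (hχ : ∀ g m, χ (M.ρ g m) = χ m) (m : M) (hm : χ m ≠ 0)
    (hN : ∑ g : G, M.ρ g m = 0) : ¬ IsFlabby M := by
  classical
  intro hfl
  set M' := Rep.res (⊤ : Subgroup G).subtype M
  obtain ⟨z, hz⟩ := exists_d₁₀_eq_of_norm_eq_zero M' (hfl ⊤) m <|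
    (Equiv.sum_comp Subgroup.topEquiv.toEquiv (fun g => M.ρ g m)).trans hN
  have key : ∀ z : (⊤ : Subgroup G) →₀ M, χ (groupHomology.d₁₀ M' z) = 0 := by
    intro z
    induction z using Finsupp.induction_linear with
    | zero => exact (congrArg χ (map_zero _)).trans (map_zero χ)
    | add a b ha hb =>
      refine (congrArg χ (map_add (groupHomology.d₁₀ M').hom a b)).trans ?_
      exact (map_add χ _ _).trans (by rw [ha, hb, add_zero])
    | single g a =>
      refine (congrArg χ (groupHomology.d₁₀_single M' g a)).trans ?_
      exact (map_sub χ _ _).trans (sub_eq_zero.2 (hχ _ a))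
  exact hm ((congrArg χ hz).symm.trans (key _))

theorem isCoflabby_of_cocycles {G : Type} [Group G] [Finite G] (M : Rep.{0} ℤ G)
    (h : ∀ (S : Subgroup G) (f : S → M), (∀ a b, f (a * b) = M.ρ a (f b) + f a) →
      ∃ m, ∀ a : S, f a = M.ρ a m - m) : IsCoflabby M := by
  intro S _
  set M' := Rep.res S.subtype M
  let e : tateCohomology M' 1 ≅ groupCohomology M' 1 :=
    (TateCohomology.isoGroupCohomology 1).app M'
  suffices Subsingleton (groupCohomology M' 1) from e.toLinearEquiv.toEquiv.subsingleton
  refine subsingleton_of_forall_eq 0 fun x => ?_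
  induction x using groupCohomology.H1_induction_on with | h x => ?_
  rw [groupCohomology.H1π_eq_zero_iff]
  obtain ⟨m, hm⟩ := h S x ((groupCohomology.mem_cocycles₁_iff x).1 x.2)
  exact ⟨m, by ext a; exact (hm a).symm⟩

end GLattice

namespace RelationModule

open GLattice

/-- The oriented edges of the Cayley graph of `G` with respect to a family of elements indexed by
`ι`: an edge is given by the vertex where it starts and by its label. -/
@[ext]
structure Edge (G ι : Type) where
  /-- The vertex where the edge starts. -/
  source : G
  /-- The label of the edge. -/
  label : ι
  deriving DecidableEq, Fintype

instance {G ι : Type} [Group G] : MulAction G (Edge G ι) where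
  smul g e := ⟨g * e.source, e.label⟩
  one_smul _ := Edge.ext (one_mul _) rfl
  mul_smul _ _ _ := Edge.ext (mul_assoc _ _ _) rfl

theorem Edge.smul_mk {G ι : Type} [Group G] (g h : G) (i : ι) :
    g • (⟨h, i⟩ : Edge G ι) = ⟨g * h, i⟩ := rfl

theorem _root_.FreeGroupBasis.induction_on {F ι : Type} [Group F]
    {p : F → Prop} (s : FreeGroupBasis ι F) (x : F) (one : p 1) (basis : ∀ i, p (s i)) (inv : ∀ x, p x → p x⁻¹)
    (mul : ∀ x y, p x → p y → p (x * y)) : p x := by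
  have h : ∀ y, p (s.repr.symm y) := fun y => by
    induction y using FreeGroup.induction_on with
    | C1 => simpa using one
    | of i => exact basis i
    | inv_of i h => rw [map_inv]; exact inv _ h
    | mul x y hx hy => rw [map_mul]; exact mul _ _ hx hy
  simpa using h (s.repr x)

theorem exists_crossedHom {F G ι V : Type} [Group F] [Group G] [AddCommGroup V]
    (s : FreeGroupBasis ι F) (ε : F →* G) (ρ : Representation ℤ G V) (v : ι → V) :
    ∃ D : F → V, (∀ i, D (s i) = v i) ∧ ∀ x y, D (x * y) = D x + ρ (ε x) (D y) := by
  let φ : G →* MulAut (Multiplicative V) :=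
    { toFun := fun g =>
        { toFun := fun a => Multiplicative.ofAdd (ρ g a.toAdd)
          invFun := fun a => Multiplicative.ofAdd (ρ g⁻¹ a.toAdd)
          left_inv := fun a => by simp
          right_inv := fun a => by simp
          map_mul' := fun a b => by simp }
      map_one' := by ext; simp
      map_mul' := fun g h => by ext; simp }
  let Φ : F →* SemidirectProduct (Multiplicative V) G φ :=
    s.lift fun i => ⟨Multiplicative.ofAdd (v i), ε (s i)⟩
  have hΦ : ∀ i, Φ (s i) = ⟨Multiplicative.ofAdd (v i), ε (s i)⟩ := fun i => by simp [Φ]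
  have hε : SemidirectProduct.rightHom.comp Φ = ε := s.ext_hom _ _ fun i => by simp [hΦ]
  refine ⟨fun x => (Φ x).left.toAdd, fun i => by simp [hΦ], fun x y => ?_⟩
  simp only [map_mul, SemidirectProduct.mul_left, toAdd_mul]
  rw [← hε]
  rfl

section Class

variable {F G : Type} [Group F] [Group G] (ε : F →* G)

/-- The class in `Rᵃᵇ` of an element of `R`. -/
def relClass (r : ε.ker) : Additive (Abelianization ε.ker) := Additive.ofMul (Abelianization.of r)

theorem relClass_mul (r r' : ε.ker) : relClass ε (r * r') = relClass ε r + relClass ε r' := rfl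

theorem relClass_surjective : Function.Surjective (relClass ε) := by
  intro m
  induction m using Additive.rec with | ofMul x => ?_
  induction x using QuotientGroup.induction_on with | H x => exact ⟨x, rfl⟩

theorem rep_relClass (hε : Function.Surjective ε) (f : F) (r : ε.ker) :
    rep ε hε (ε f) (relClass ε r) = relClass ε (MulAut.conjNormal f r) :=
  rep_apply ε hε f r

/-- The additive homomorphism on `Rᵃᵇ` induced by a homomorphism from `R` to an abelian group. -/
def liftRel {A : Type} [AddCommGroup A] (φ : ε.ker → A) (hφ : ∀ r r', φ (r * r') = φ r + φ r') :
    Additive (Abelianization ε.ker) →+ A :=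
  MonoidHom.toAdditiveLeft (Abelianization.lift
    (MonoidHom.mk' (fun r => Multiplicative.ofAdd (φ r)) hφ))

theorem liftRel_relClass {A : Type} [AddCommGroup A] (φ : ε.ker → A)
    (hφ : ∀ r r', φ (r * r') = φ r + φ r') (r : ε.ker) : liftRel ε φ hφ (relClass ε r) = φ r := rfl

variable {ε} {t : G → F} (ht : ∀ g, ε (t g) = g)

/-- For a section `t` of `ε`, the class of the loop in the Cayley graph that runs from `1` to `g`
along `t g`, then spells `w`, and returns along the inverse of `t (g * ε w)`. -/
def loopClass (g : G) (w : F) : Additive (Abelianization ε.ker) :=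
  relClass ε ⟨t g * w * (t (g * ε w))⁻¹, by simp [MonoidHom.mem_ker, ht]⟩

theorem loopClass_mul (g : G) (x y : F) :
    loopClass ht g (x * y) = loopClass ht g x + loopClass ht (g * ε x) y := by
  rw [loopClass, loopClass, loopClass, ← relClass_mul]
  congr 1
  ext
  simp [mul_assoc]

theorem loopClass_one (g : G) : loopClass ht g 1 = 0 := by
  simpa using loopClass_mul ht g 1 1

theorem loopClass_inv (g : G) (x : F) :
    loopClass ht g x⁻¹ = -loopClass ht (g * (ε x)⁻¹) x := by
  have h := loopClass_mul ht g x⁻¹ x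
  rw [inv_mul_cancel, loopClass_one, map_inv] at h
  exact eq_neg_of_add_eq_zero_left h.symm

theorem loopClass_rel (r : ε.ker) : loopClass ht 1 r = relClass ε r := by
  have h1 : t 1 ∈ ε.ker := by simp [MonoidHom.mem_ker, ht]
  have h : loopClass ht 1 r = relClass ε (⟨t 1, h1⟩ * r * ⟨t 1, h1⟩⁻¹) := by
    rw [loopClass]
    congr 1
    ext
    simp [show ε r = 1 from r.2]
  rw [h, relClass_mul, relClass_mul, add_right_comm, ← relClass_mul, mul_inv_cancel]
  exact zero_add _

end Class

set_option linter.unusedSectionVars false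

section Fox

variable {F G ι : Type} [Group F] [Group G] [DecidableEq G] [DecidableEq ι]
  (s : FreeGroupBasis ι F) (ε : F →* G)

/-- The Fox derivative with values in the edge functions of the Cayley graph: `foxDeriv s ε x` counts
the edges passed by the path that starts at `1` and spells the word `x`. -/
noncomputable def foxDeriv : F → Edge G ι → ℤ :=
  (exists_crossedHom s ε (funRep ℤ G (Edge G ι)) fun i => Pi.single ⟨1, i⟩ 1).choose

theorem foxDeriv_basis (i : ι) : foxDeriv s ε (s i) = Pi.single ⟨1, i⟩ 1 :=
  (exists_crossedHom s ε (funRep ℤ G (Edge G ι)) fun i => Pi.single ⟨1, i⟩ 1).choose_spec.1 i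

theorem foxDeriv_mul (x y : F) :
    foxDeriv s ε (x * y) = foxDeriv s ε x + funRep ℤ G _ (ε x) (foxDeriv s ε y) :=
  (exists_crossedHom s ε (funRep ℤ G (Edge G ι)) fun i => Pi.single ⟨1, i⟩ 1).choose_spec.2 x y

theorem foxDeriv_one : foxDeriv s ε 1 = 0 := by
  have h := foxDeriv_mul s ε 1 1
  simpa using h

theorem foxDeriv_inv (x : F) :
    foxDeriv s ε x⁻¹ = -funRep ℤ G _ (ε x)⁻¹ (foxDeriv s ε x) := by
  have h := foxDeriv_mul s ε x⁻¹ x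
  rw [inv_mul_cancel, foxDeriv_one, map_inv] at h
  exact eq_neg_of_add_eq_zero_left h.symm

/-- The map that `foxDeriv` induces on `Rᵃᵇ`. -/
noncomputable def foxMap : Additive (Abelianization ε.ker) →+ (Edge G ι → ℤ) :=
  liftRel ε (fun r => foxDeriv s ε r) fun r r' => by
    rw [Subgroup.coe_mul, foxDeriv_mul, show ε r = 1 from r.2, map_one]
    rfl

theorem foxMap_relClass (r : ε.ker) : foxMap s ε (relClass ε r) = foxDeriv s ε r := rfl

theorem foxMap_rep (hε : Function.Surjective ε) (g : G) (m : Additive (Abelianization ε.ker)) :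
    foxMap s ε (rep ε hε g m) = funRep ℤ G _ g (foxMap s ε m) := by
  obtain ⟨f, rfl⟩ := hε g
  obtain ⟨r, rfl⟩ := relClass_surjective ε m
  rw [rep_relClass, foxMap_relClass, foxMap_relClass, MulAut.conjNormal_apply, foxDeriv_mul,
    foxDeriv_mul, foxDeriv_inv, map_neg, ← Module.End.mul_apply, ← map_mul]
  simp [show ε r = 1 from r.2]

variable [Fintype G] [Fintype ι] {ε} {t : G → F} (ht : ∀ g, ε (t g) = g)

/-- The retraction of `foxMap` that sends an edge to the class of the loop that the section `t` and
the edge determine. -/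
noncomputable def edgeMap : (Edge G ι → ℤ) →ₗ[ℤ] Additive (Abelianization ε.ker) :=
  Fintype.linearCombination ℤ fun e => loopClass ht e.source (s e.label)

theorem edgeMap_single (e : Edge G ι) (k : ℤ) :
    edgeMap s ht (Pi.single e k) = k • loopClass ht e.source (s e.label) :=
  Fintype.linearCombination_apply_single _ _ _ _

theorem edgeMap_apply (v : Edge G ι → ℤ) :
    edgeMap s ht v = ∑ e, v e • loopClass ht e.source (s e.label) := rfl

theorem edgeMap_foxDeriv (g : G) (w : F) :
    edgeMap s ht (funRep ℤ G _ g (foxDeriv s ε w)) = loopClass ht g w := by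
  induction w using s.induction_on generalizing g with
  | one => simp [foxDeriv_one, loopClass_one]
  | basis i => simp [foxDeriv_basis, funRep_single, edgeMap_single, Edge.smul_mk]
  | inv x h =>
    rw [foxDeriv_inv, map_neg, map_neg, ← Module.End.mul_apply, ← map_mul, h, loopClass_inv]
  | mul x y hx hy =>
    rw [foxDeriv_mul, map_add, map_add, ← Module.End.mul_apply, ← map_mul, hx, hy, loopClass_mul]

theorem edgeMap_foxMap (m : Additive (Abelianization ε.ker)) : edgeMap s ht (foxMap s ε m) = m := by
  obtain ⟨r, rfl⟩ := relClass_surjective ε m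
  rw [foxMap_relClass, ← loopClass_rel ht, ← edgeMap_foxDeriv s, map_one]
  rfl

theorem foxMap_injective (hε : Function.Surjective ε) : Function.Injective (foxMap s ε) := by
  obtain ⟨t, ht⟩ := hε.hasRightInverse
  exact Function.LeftInverse.injective (edgeMap_foxMap s ht)

variable (ε) in
/-- The boundary map of the Cayley graph. -/
noncomputable def boundary : (Edge G ι → ℤ) →ₗ[ℤ] (G → ℤ) :=
  Fintype.linearCombination ℤ fun e =>
    Pi.single (e.source * ε (s e.label)) 1 - Pi.single e.source 1

/-- The map that sends a vertex `g` to the path `t g` from `1` to `g`. -/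
noncomputable def pathMap (t : G → F) : (G → ℤ) →ₗ[ℤ] (Edge G ι → ℤ) :=
  Fintype.linearCombination ℤ fun g => foxDeriv s ε (t g)

theorem boundary_single (e : Edge G ι) : boundary s ε (Pi.single e 1) =
    Pi.single (e.source * ε (s e.label)) 1 - Pi.single e.source 1 := by
  rw [boundary, Fintype.linearCombination_apply_single, one_smul]

theorem pathMap_single (g : G) : pathMap s (ε := ε) t (Pi.single g 1) = foxDeriv s ε (t g) := by
  rw [pathMap, Fintype.linearCombination_apply_single, one_smul]

theorem foxMap_edgeMap_add_pathMap_boundary (v : Edge G ι → ℤ) :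
    foxMap s ε (edgeMap s ht v) + pathMap s (ε := ε) t (boundary s ε v) = v := by
  suffices (foxMap s ε).toIntLinearMap ∘ₗ edgeMap s ht + pathMap s (ε := ε) t ∘ₗ boundary s ε =
    LinearMap.id from LinearMap.congr_fun this v
  refine LinearMap.pi_ext' fun e => LinearMap.ext_ring ?_
  change foxMap s ε (edgeMap s ht (Pi.single e 1)) +
    pathMap s (ε := ε) t (boundary s ε (Pi.single e 1)) = Pi.single e 1
  rw [edgeMap_single, one_smul, boundary_single, map_sub, pathMap_single, pathMap_single, loopClass,
    foxMap_relClass, foxDeriv_mul, foxDeriv_mul, foxDeriv_inv, foxDeriv_basis, funRep_single, map_neg,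
    ← Module.End.mul_apply, ← map_mul]
  obtain ⟨h, i⟩ := e
  simp only [map_mul, ht, Edge.smul_mk, mul_one, mul_inv_cancel, map_one, Module.End.one_apply]
  abel

theorem boundary_funRep (g : G) (v : Edge G ι → ℤ) :
    boundary s ε (funRep ℤ G _ g v) = funRep ℤ G _ g (boundary s ε v) := by
  suffices boundary s ε ∘ₗ funRep ℤ G _ g = funRep ℤ G _ g ∘ₗ boundary s ε from
    LinearMap.congr_fun this v
  refine LinearMap.pi_ext' fun e => LinearMap.ext_ring ?_
  change boundary s ε (funRep ℤ G _ g (Pi.single e 1)) =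
    funRep ℤ G _ g (boundary s ε (Pi.single e 1))
  rw [funRep_single, boundary_single, boundary_single, map_sub, funRep_single, funRep_single]
  obtain ⟨h, i⟩ := e
  simp [Edge.smul_mk, mul_assoc]

theorem boundary_foxDeriv (x : F) :
    boundary s ε (foxDeriv s ε x) = Pi.single (ε x) 1 - Pi.single 1 1 := by
  induction x using s.induction_on with
  | one => simp [foxDeriv_one]
  | basis i => simp [foxDeriv_basis, boundary_single]
  | inv x h => simp [foxDeriv_inv, boundary_funRep, h, funRep_single]
  | mul x y hx hy => simp [foxDeriv_mul, boundary_funRep, hx, hy, funRep_single]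

theorem boundary_foxMap (m : Additive (Abelianization ε.ker)) :
    boundary s ε (foxMap s ε m) = 0 := by
  obtain ⟨r, rfl⟩ := relClass_surjective ε m
  rw [foxMap_relClass, boundary_foxDeriv, show ε r = 1 from r.2, sub_self]

theorem boundary_pathMap (ht : ∀ g, ε (t g) = g) (u : G → ℤ) (hu : ∑ g, u g = 0) :
    boundary s ε (pathMap s (ε := ε) t u) = u := by
  rw [pathMap, Fintype.linearCombination_apply, map_sum]
  simp only [map_smul, boundary_foxDeriv, ht, smul_sub, Finset.sum_sub_distrib, ← Finset.sum_smul,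
    hu, zero_smul, sub_zero]
  ext g
  simp [Finset.sum_apply, Pi.single_apply]

theorem sum_boundary (v : Edge G ι → ℤ) : ∑ g, boundary s ε v g = 0 := by
  rw [boundary, Fintype.linearCombination_apply]
  simp only [Finset.sum_apply, Pi.smul_apply, Pi.sub_apply]
  rw [Finset.sum_comm]
  simp [← Finset.mul_sum]

end Fox

end RelationModule

namespace RelationModule

open GLattice
open scoped commutatorElement

/-- A subgroup `S` admits an `S`-equivariant map `G → S`, for left multiplication. -/
theorem exists_equivariant_retraction {G : Type} [Group G] (S : Subgroup G) :
    ∃ p : G → S, ∀ (a : S) (g : G), p (a * g) = a * p g := by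
  let q : G → G := fun g => (Quotient.mk (QuotientGroup.rightRel S) g).out
  have hq : ∀ g, g * (q g)⁻¹ ∈ S := fun g =>
    QuotientGroup.rightRel_apply.1 (Quotient.mk_out (s := QuotientGroup.rightRel S) g)
  refine ⟨fun g => ⟨g * (q g)⁻¹, hq g⟩, fun a g => ?_⟩
  have h : q (a * g) = q g := congrArg Quotient.out <| Quotient.sound <|
    QuotientGroup.rightRel_apply.2 (by simp [mul_inv_rev, ← mul_assoc])
  ext
  simp [h, mul_assoc]

/-- The first cohomology of a subgroup of `G` with values in the functions on the edges vanishes. -/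
theorem exists_funRep_sub_eq {G ι : Type} [Group G] (S : Subgroup G) (c : S → Edge G ι → ℤ)
    (hc : ∀ a b : S, c (a * b) = funRep ℤ G _ a (c b) + c a) :
    ∃ v, ∀ a : S, c a = funRep ℤ G _ a v - v := by
  obtain ⟨p, hp⟩ := exists_equivariant_retraction S
  refine ⟨fun e => -c (p e.source) e, fun a => ?_⟩
  ext e
  have h1 : p e.source = a * p ((a : G)⁻¹ * e.source) := by rw [← hp, mul_inv_cancel_left]
  have h2 := congrFun (hc a (p ((a : G)⁻¹ * e.source))) e
  rw [← h1, Pi.add_apply, funRep_apply] at h2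
  have h3 : ((a : G)⁻¹ • e).source = (a : G)⁻¹ * e.source := rfl
  rw [Pi.sub_apply, funRep_apply, h3, h2]
  ring

/-- A function on `G` that is invariant under a subgroup `S` is a norm, from a function of sum zero
if its own sum is zero. -/
theorem exists_sum_funRep_eq {G : Type} [Group G] [Fintype G] (S : Subgroup G) [Fintype S]
    (w : G → ℤ) (hw : ∀ a : S, funRep ℤ G G a w = w) (h0 : ∑ g, w g = 0) :
    ∃ u : G → ℤ, ∑ a : S, funRep ℤ G G a u = w ∧ ∑ g, u g = 0 := by
  classical
  obtain ⟨p, hp⟩ := exists_equivariant_retraction S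
  let u : G → ℤ := fun g => if p g = 1 then w g else 0
  have hu : ∑ a : S, funRep ℤ G G a u = w := by
    ext g
    have h : ∀ a : S, funRep ℤ G G a u g = if a = p g then w g else 0 := fun a => by
      have h1 : p ((a : G)⁻¹ * g) = a⁻¹ * p g := hp a⁻¹ g
      have h2 : w ((a : G)⁻¹ * g) = w g := congrFun (hw a) g
      simp only [funRep_apply, smul_eq_mul, u, h1, h2, inv_mul_eq_one]
    simp [Finset.sum_apply, h]
  refine ⟨u, hu, ?_⟩
  have h : ∑ g, w g = Fintype.card S * ∑ g, u g := by
    rw [← hu]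
    simp only [Finset.sum_apply]
    rw [Finset.sum_comm]
    have h1 : ∀ a : S, ∑ g, funRep ℤ G G a u g = ∑ g, u g := fun a =>
      Equiv.sum_comp (MulAction.toPerm (a : G)⁻¹) u
    simp [h1]
  rw [h0] at h
  exact (mul_eq_zero.1 h.symm).resolve_left (by simp)

theorem isCoflabby {F G ι : Type} [Group F] [Group G] [Finite G] [Finite ι]
    (s : FreeGroupBasis ι F) (ε : F →* G) (hε : Function.Surjective ε) :
    IsCoflabby (relationModule ε hε) := by
  classical
  have := Fintype.ofFinite G
  have := Fintype.ofFinite ι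
  obtain ⟨t, ht⟩ := hε.hasRightInverse
  refine isCoflabby_of_cocycles _ fun S f hf => ?_
  change S → Additive (Abelianization ε.ker) at f
  change ∀ a b : S, f (a * b) = rep ε hε a (f b) + f a at hf
  obtain ⟨v, hv⟩ := exists_funRep_sub_eq S (fun a => foxMap s ε (f a)) fun a b => by
    rw [hf, map_add, foxMap_rep]
  obtain ⟨u, hu, hu0⟩ := exists_sum_funRep_eq S (boundary s ε v) (fun a => by
    rw [← boundary_funRep, ← sub_eq_zero, ← map_sub, ← hv, boundary_foxMap]) (sum_boundary s v)
  let z : Edge G ι → ℤ := v - ∑ a : S, funRep ℤ G _ a (pathMap s (ε := ε) t u)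
  have hz : boundary s ε z = 0 := by
    simp only [z, map_sub, map_sum, boundary_funRep, boundary_pathMap s ht u hu0, hu, sub_self]
  have hz' : ∀ a : S, funRep ℤ G _ a z - z = funRep ℤ G _ a v - v := fun a => by
    have h : funRep ℤ G _ a (∑ b : S, funRep ℤ G _ b (pathMap s (ε := ε) t u)) =
        ∑ b : S, funRep ℤ G _ b (pathMap s (ε := ε) t u) := by
      rw [map_sum, ← Equiv.sum_comp (Equiv.mulLeft a)
        (fun b : S => funRep ℤ G _ b (pathMap s (ε := ε) t u))]
      simp [← Module.End.mul_apply]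
    simp only [z, map_sub, h]
    abel
  have hm := foxMap_edgeMap_add_pathMap_boundary s ht z
  rw [hz, map_zero, add_zero] at hm
  refine ⟨edgeMap s ht z, fun a => foxMap_injective s hε ?_⟩
  change foxMap s ε (f a) = foxMap s ε (rep ε hε a (edgeMap s ht z) - edgeMap s ht z)
  rw [map_sub, foxMap_rep, hm, hz', hv]

theorem isLattice {F G ι : Type} [Group F] [Group G] [Finite G] [Finite ι]
    (s : FreeGroupBasis ι F) (ε : F →* G) (hε : Function.Surjective ε) :
    IsLattice (relationModule ε hε) := by
  classical
  have := Fintype.ofFinite G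
  have := Fintype.ofFinite ι
  obtain ⟨t, ht⟩ := hε.hasRightInverse
  exact ⟨Module.Finite.of_surjective (edgeMap s ht)
      (Function.RightInverse.surjective (edgeMap_foxMap s ht)),
    Function.Injective.isAddTorsionFree (foxMap s ε) (foxMap_injective s hε)⟩

theorem norm_commutator {F G ι : Type} [Group F] [Group G] [Fintype G] [Finite ι]
    (s : FreeGroupBasis ι F) (ε : F →* G) (hε : Function.Surjective ε) (a b : F)
    (h : ⁅a, b⁆ ∈ ε.ker) : ∑ g : G, rep ε hε g (relClass ε ⟨⁅a, b⁆, h⟩) = 0 := by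
  classical
  have := Fintype.ofFinite ι
  apply foxMap_injective s hε
  rw [map_sum, map_zero]
  simp only [foxMap_rep, foxMap_relClass]
  have hab : ε a * ε b * (ε a)⁻¹ = ε b := by
    have h1 : ε ⁅a, b⁆ = 1 := h
    rw [commutatorElement_def, map_mul, map_inv, mul_inv_eq_one] at h1
    simpa using h1
  have h2 : foxDeriv s ε ⁅a, b⁆ = (foxDeriv s ε a - funRep ℤ G _ (ε b) (foxDeriv s ε a)) +
      (funRep ℤ G _ (ε a) (foxDeriv s ε b) - foxDeriv s ε b) := by
    rw [commutatorElement_def, foxDeriv_mul, foxDeriv_mul, foxDeriv_mul, foxDeriv_inv, foxDeriv_inv]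
    have h3 : ε (a * b) * (ε a)⁻¹ = ε b := by rw [map_mul, hab]
    have h4 : ε (a * b * a⁻¹) * (ε b)⁻¹ = 1 := by
      rw [map_mul, map_mul, map_inv, hab, mul_inv_cancel]
    simp only [map_neg, ← Module.End.mul_apply, ← map_mul, h3, h4]
    simp only [map_one, Module.End.one_apply]
    abel
  have h3 : ∀ (c : G) (v : Edge G ι → ℤ),
      ∑ g, funRep ℤ G _ g (funRep ℤ G _ c v) = ∑ g, funRep ℤ G _ g v := fun c v => by
    rw [← Equiv.sum_comp (Equiv.mulRight c) (fun g => funRep ℤ G _ g v)]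
    simp
  simp only [h2, map_add, map_sub, Finset.sum_add_distrib, Finset.sum_sub_distrib, h3, sub_self,
    add_zero]

end RelationModule

namespace GLattice

/-- A finite `G`-set with an equivariant family of elements and an equivariant family of functionals
through which multiplication by `k` factors. -/
def HasDualSystem {G V : Type} [Group G] [AddCommGroup V] (ρ : Representation ℤ G V) (k : ℤ) :
    Prop :=
  ∃ (X : Type) (_ : MulAction G X) (_ : Fintype X) (f : X → V) (α : X → V →+ ℤ),
    (∀ (g : G) x, f (g • x) = ρ g (f x)) ∧ (∀ (g : G) x m, α (g • x) (ρ g m) = α x m) ∧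
      ∀ m, ∑ x, α x m • f x = k • m

section

variable {G V : Type} [Group G] [AddCommGroup V] {ρ : Representation ℤ G V}

theorem HasDualSystem.add {k l : ℤ} (hk : HasDualSystem ρ k) (hl : HasDualSystem ρ l) :
    HasDualSystem ρ (k + l) := by
  obtain ⟨X, _, _, f, α, hf, hα, h⟩ := hk
  obtain ⟨Y, _, _, f', α', hf', hα', h'⟩ := hl
  refine ⟨X ⊕ Y, inferInstance, inferInstance, Sum.elim f f', Sum.elim α α', fun g x => ?_,
    fun g x m => ?_, fun m => ?_⟩
  · cases x with
    | inl x => exact hf g x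
    | inr x => exact hf' g x
  · cases x with
    | inl x => exact hα g x m
    | inr x => exact hα' g x m
  · simp [h, h', add_smul]

theorem HasDualSystem.mul_left {k : ℤ} (hk : HasDualSystem ρ k) (c : ℤ) :
    HasDualSystem ρ (c * k) := by
  obtain ⟨X, _, _, f, α, hf, hα, h⟩ := hk
  refine ⟨X, inferInstance, inferInstance, fun x => c • f x, α, fun g x => ?_, hα, fun m => ?_⟩
  · change c • f (g • x) = ρ g (c • f x)
    rw [hf, map_zsmul]
  · simp only [smul_comm _ c, ← Finset.smul_sum, h, mul_smul]

theorem isInvertible_of_isCoprime {k l : ℤ} (hk : HasDualSystem ρ k) (hl : HasDualSystem ρ l)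
    (h : IsCoprime k l) : IsInvertible (Rep.of ρ) := by
  obtain ⟨a, b, hab⟩ := h
  obtain ⟨X, _, _, f, α, hf, hα, h⟩ := (hk.mul_left a).add (hl.mul_left b)
  refine isInvertible_of_dualSystem (Rep.of ρ) f hf α hα fun m => ?_
  exact (h m).trans (by rw [hab, one_smul])

theorem apply_out_mk {A : Type} {S : Subgroup G} {φ : G → A} (hφ : ∀ h, ∀ a ∈ S, φ (h * a) = φ h)
    (h : G) : φ (h : G ⧸ S).out = φ h := by
  obtain ⟨a, ha⟩ := QuotientGroup.mk_out_eq_mul S h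
  rw [ha, hφ h a a.2]

theorem sum_mul_out {S : Subgroup G} [Fintype (G ⧸ S)] {φ : G → V}
    (hφ : ∀ h, ∀ a ∈ S, φ (h * a) = φ h) (g : G) :
    ∑ q : G ⧸ S, φ (g * q.out) = ∑ q : G ⧸ S, φ q.out := by
  rw [← Equiv.sum_comp (MulAction.toPerm g) (fun q : G ⧸ S => φ q.out)]
  refine Finset.sum_congr rfl fun q _ => ?_
  rw [← apply_out_mk hφ]
  congr 2
  conv_rhs => rw [MulAction.toPerm_apply, ← q.out_eq']
  rfl

/-- Summing over `G ⧸ S` the conjugates of a factorization of the identity that is only equivariant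
under `S` gives a factorization of the multiplication by the index. -/
theorem hasDualSystem_index {X : Type} [MulAction G X] [Fintype X] (S : Subgroup G)
    [S.FiniteIndex] (γ : X → V →+ ℤ) (hγ : ∀ (g : G) x m, γ (g • x) (ρ g m) = γ x m)
    (π : X → V) (hπ : ∀ a ∈ S, ∀ x, π (a • x) = ρ a (π x))
    (m₀ : V) (hm₀ : ∀ a ∈ S, ρ a m₀ = m₀) (β : V →+ ℤ) (hβ : ∀ a ∈ S, ∀ m, β (ρ a m) = β m)
    (h : ∀ m, ∑ x, γ x m • π x + β m • m₀ = m) : HasDualSystem ρ S.index := by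
  have := Subgroup.fintypeQuotientOfFiniteIndex (H := S)
  have hγ' : ∀ (g : G) x m, γ x (ρ g⁻¹ m) = γ (g • x) m := fun g x m => by
    rw [← hγ g, ← Module.End.mul_apply, ← map_mul, mul_inv_cancel, map_one, Module.End.one_apply]
  have h1 : ∀ x : X, ∀ k : G, ∀ a ∈ S,
      ρ (k * a) (π ((k * a)⁻¹ • x)) = ρ k (π (k⁻¹ • x)) := fun x k a ha => by
    rw [map_mul, Module.End.mul_apply, ← hπ a ha, smul_smul, mul_inv_rev, mul_inv_cancel_left]
  have h2 : ∀ k : G, ∀ a ∈ S, ρ (k * a) m₀ = ρ k m₀ := fun k a ha => by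
    rw [map_mul, Module.End.mul_apply, hm₀ a ha]
  have h3 : ∀ m, ∀ k : G, ∀ a ∈ S, β (ρ (k * a)⁻¹ m) = β (ρ k⁻¹ m) := fun m k a ha => by
    rw [mul_inv_rev, map_mul, Module.End.mul_apply, hβ _ (S.inv_mem ha)]
  have hout : ∀ (g : G) (q : G ⧸ S), g • q = ((g * q.out : G) : G ⧸ S) := fun g q => by
    conv_lhs => rw [← q.out_eq']
    rfl
  refine ⟨X ⊕ (G ⧸ S), inferInstance, inferInstance,
    Sum.elim (fun x => ∑ q : G ⧸ S, ρ q.out (π (q.out⁻¹ • x))) (fun q => ρ q.out m₀),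
    Sum.elim γ (fun q => β.comp (ρ q.out⁻¹).toAddMonoidHom), fun g x => ?_, fun g x m => ?_,
    fun m => ?_⟩
  · cases x with
    | inl x =>
      change ∑ q : G ⧸ S, ρ q.out (π (q.out⁻¹ • g • x)) =
        ρ g (∑ q : G ⧸ S, ρ q.out (π (q.out⁻¹ • x)))
      rw [← sum_mul_out (φ := fun k => ρ k (π (k⁻¹ • g • x))) (h1 (g • x)) g, map_sum]
      simp [mul_smul]
    | inr q =>
      change ρ (g • q).out m₀ = ρ g (ρ q.out m₀)
      rw [hout, apply_out_mk (φ := fun k => ρ k m₀) h2, map_mul, Module.End.mul_apply]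
  · cases x with
    | inl x => exact hγ g x m
    | inr q =>
      change β (ρ (g • q).out⁻¹ (ρ g m)) = β (ρ q.out⁻¹ m)
      rw [hout, apply_out_mk (φ := fun k => β (ρ k⁻¹ (ρ g m))) (h3 _), ← Module.End.mul_apply, ← map_mul, mul_inv_rev,
        inv_mul_cancel_right]
  · have h4 : ∀ k : G, ∑ x, γ x m • ρ k (π (k⁻¹ • x)) + β (ρ k⁻¹ m) • ρ k m₀ = m := fun k => by
      have h5 := congrArg (ρ k) (h (ρ k⁻¹ m))
      rw [← Module.End.mul_apply, ← map_mul, mul_inv_cancel, map_one, Module.End.one_apply, map_add,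
        map_sum] at h5
      simp only [map_zsmul, hγ'] at h5
      rw [← Equiv.sum_comp (MulAction.toPerm k)]
      simpa using h5
    rw [Fintype.sum_sum_type]
    change ∑ x, γ x m • ∑ q : G ⧸ S, ρ q.out (π (q.out⁻¹ • x)) +
      ∑ q : G ⧸ S, β (ρ q.out⁻¹ m) • ρ q.out m₀ = _
    simp only [Finset.smul_sum]
    rw [Finset.sum_comm, ← Finset.sum_add_distrib]
    simp only [h4]
    simp [Subgroup.index_eq_card, Nat.card_eq_fintype_card]

end

end GLattice

namespace RelationModule

open GLattice

/-- For a cyclic subgroup generated by `ε c`, some section of `ε` is equivariant under that subgroup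
up to powers of `c`. -/
theorem exists_section_zpowers {F G : Type} [Group F] [Group G] (ε : F →* G)
    (hε : Function.Surjective ε) (c : F) : ∃ t : G → F, (∀ g, ε (t g) = g) ∧
      ∀ a ∈ Subgroup.zpowers (ε c), ∀ g, t (a * g) * (t g)⁻¹ ∈ Subgroup.zpowers c := by
  obtain ⟨p, hp⟩ := exists_equivariant_retraction (Subgroup.zpowers (ε c))
  obtain ⟨t₀, ht₀⟩ := hε.hasRightInverse
  have hl : ∀ a : Subgroup.zpowers (ε c), ∃ l ∈ Subgroup.zpowers c, ε l = a := by
    rintro ⟨_, k, rfl⟩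
    exact ⟨c ^ k, ⟨k, rfl⟩, map_zpow ε c k⟩
  choose l hlc hlε using hl
  refine ⟨fun g => l (p g) * t₀ ((p g : G)⁻¹ * g), fun g => ?_, fun a ha g => ?_⟩
  · rw [map_mul, hlε, ht₀, mul_inv_cancel_left]
  · have h := hp ⟨a, ha⟩ g
    simp only at h
    have h2 : ((p (a * g) : G)⁻¹ * (a * g)) = (p g : G)⁻¹ * g := by
      simp [h, mul_assoc]
    simp only [h2, mul_inv_rev, mul_assoc, mul_inv_cancel_left]
    exact mul_mem (hlc _) (inv_mem (hlc _))

/-- The class of the relation `c ^ k`, where `k` is the order of `ε c`. -/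
noncomputable def powClass {F G : Type} [Group F] [Group G] (ε : F →* G) (c : F) :
    Additive (Abelianization ε.ker) :=
  relClass ε ⟨c ^ orderOf (ε c), by rw [MonoidHom.mem_ker, map_pow, pow_orderOf_eq_one]⟩

theorem relClass_eq_zsmul_powClass {F G : Type} [Group F] [Group G] (ε : F →* G) (c : F)
    (z : ε.ker) (hz : (z : F) ∈ Subgroup.zpowers c) : ∃ k : ℤ, relClass ε z = k • powClass ε c := by
  obtain ⟨j, hj⟩ := hz
  simp only at hj
  have h1 : ε c ^ j = 1 := by rw [← map_zpow, hj]; exact z.2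
  obtain ⟨k, hk⟩ := orderOf_dvd_iff_zpow_eq_one.2 h1
  refine ⟨k, ?_⟩
  rw [powClass, relClass, relClass, ← ofMul_zpow, ← map_zpow]
  congr 2
  ext
  rw [← hj, hk, zpow_mul, zpow_natCast]
  rfl

theorem rep_powClass {F G : Type} [Group F] [Group G] (ε : F →* G) (hε : Function.Surjective ε)
    (c : F) (a : G) (ha : a ∈ Subgroup.zpowers (ε c)) :
    rep ε hε a (powClass ε c) = powClass ε c := by
  obtain ⟨k, rfl⟩ := ha
  simp only
  rw [← map_zpow, powClass, rep_relClass]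
  congr 1
  ext
  rw [MulAut.conjNormal_apply]
  simp only
  rw [((Commute.refl c).zpow_left k).pow_right _ |>.eq, mul_inv_cancel_right]

/-- For a section that is equivariant under a cyclic subgroup up to powers of `c`, the loop classes
are equivariant up to multiples of the class of the power relation. -/
theorem loopClass_mul_left {F G : Type} [Group F] [Group G] {ε : F →* G}
    (hε : Function.Surjective ε) (c : F) {t : G → F} (ht : ∀ g, ε (t g) = g)
    (htc : ∀ a ∈ Subgroup.zpowers (ε c), ∀ g, t (a * g) * (t g)⁻¹ ∈ Subgroup.zpowers c)
    (a : G) (ha : a ∈ Subgroup.zpowers (ε c)) (g : G) (w : F) : ∃ k : ℤ,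
      loopClass ht (a * g) w = rep ε hε a (loopClass ht g w) + k • powClass ε c := by
  let x := t (a * g) * (t g)⁻¹
  let y := t (a * (g * ε w)) * (t (g * ε w))⁻¹
  have hx : ε x = a := by simp [x, ht]
  have hy : ε y = a := by
    simp only [y, map_mul, map_inv, ht]
    group
  have hxy : x * y⁻¹ ∈ ε.ker := by rw [MonoidHom.mem_ker, map_mul, map_inv, hx, hy, mul_inv_cancel]
  obtain ⟨k, hk⟩ := relClass_eq_zsmul_powClass ε c ⟨x * y⁻¹, hxy⟩
    (mul_mem (htc a ha _) (inv_mem (htc a ha _)))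
  refine ⟨k, ?_⟩
  rw [← hk]
  conv_rhs => rw [← hx]
  rw [loopClass, loopClass, rep_relClass, ← relClass_mul]
  congr 1
  ext
  rw [Subgroup.coe_mul, MulAut.conjNormal_apply]
  simp only [x, y]
  group

/-- Multiplication by the index of a cyclic subgroup of `G` factors through a permutation lattice on
the relation module. -/
theorem hasDualSystem_index_zpowers {F G ι : Type} [Group F] [Group G] [Finite G] [Finite ι]
    (s : FreeGroupBasis ι F) (ε : F →* G) (hε : Function.Surjective ε) (a : G) :
    HasDualSystem (rep ε hε) (Subgroup.zpowers a).index := by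
  classical
  have := Fintype.ofFinite G
  have := Fintype.ofFinite ι
  obtain ⟨c, rfl⟩ := hε a
  obtain ⟨t, ht, htc⟩ := exists_section_zpowers ε hε c
  obtain ⟨p, hp⟩ := exists_equivariant_retraction (Subgroup.zpowers (ε c))
  let π : Edge G ι → Additive (Abelianization ε.ker) := fun e =>
    rep ε hε (p e.source) (loopClass ht ((p e.source : G)⁻¹ * e.source) (s e.label))
  have hπ : ∀ a ∈ Subgroup.zpowers (ε c), ∀ e, π (a • e) = rep ε hε a (π e) := by
    rintro a ha ⟨g, i⟩
    have h := hp ⟨a, ha⟩ g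
    simp only at h
    simp only [π, Edge.smul_mk, h]
    rw [← Module.End.mul_apply, ← map_mul, Subgroup.coe_mul, mul_inv_rev, mul_assoc,
      inv_mul_cancel_left]
  have hb : ∀ e : Edge G ι, ∃ k : ℤ, loopClass ht e.source (s e.label) =
      π e + k • powClass ε c := fun e => by
    obtain ⟨k, hk⟩ := loopClass_mul_left hε c ht htc (p e.source) (p e.source).2
      ((p e.source : G)⁻¹ * e.source) (s e.label)
    rw [mul_inv_cancel_left] at hk
    exact ⟨k, hk⟩
  choose b hb using hb
  let γ : Edge G ι → Additive (Abelianization ε.ker) →+ ℤ := fun e =>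
    (Pi.evalAddMonoidHom (fun _ => ℤ) e).comp (foxMap s ε)
  have hγ : ∀ (g : G) e m, γ (g • e) (rep ε hε g m) = γ e m := fun g e m => by
    change foxMap s ε (rep ε hε g m) (g • e) = foxMap s ε m e
    rw [foxMap_rep, funRep_apply, inv_smul_smul]
  let β : Additive (Abelianization ε.ker) →+ ℤ := ∑ e, (AddMonoidHom.mulRight (b e)).comp (γ e)
  have hβ : ∀ m, β m = ∑ e, γ e m * b e := fun m => by
    simp [β, AddMonoidHom.finsetSum_apply]
  have hsum : ∀ m, ∑ e, γ e m • π e + β m • powClass ε c = m := fun m => by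
    conv_rhs => rw [← edgeMap_foxMap s ht m, edgeMap_apply]
    simp only [hb, smul_add, Finset.sum_add_distrib, hβ, Finset.sum_smul, mul_smul]
    rfl
  have hm₀ := rep_powClass ε hε c
  by_cases h0 : powClass ε c = 0
  · exact hasDualSystem_index _ γ hγ π hπ _ hm₀ 0 (fun _ _ _ => rfl) fun m => by
      simpa [h0] using hsum m
  · refine hasDualSystem_index _ γ hγ π hπ _ hm₀ β (fun a ha m => ?_) hsum
    have h1 := hsum (rep ε hε a m)
    have h2 := congrArg (rep ε hε a) (hsum m)
    rw [map_add, map_zsmul, hm₀ a ha, map_sum, ← h1] at h2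
    simp only [map_zsmul, ← hπ a ha] at h2
    rw [← Equiv.sum_comp (MulAction.toPerm a) (fun e => γ e (rep ε hε a m) • π e)] at h2
    simp only [MulAction.toPerm_apply, hγ, add_right_inj] at h2
    have := (isLattice s ε hε).torsionFree
    have h3 : IsAddTorsionFree (Additive (Abelianization ε.ker)) := this
    exact (smul_left_injective ℤ h0 h2).symm

end RelationModule

namespace RelationModule

open GLattice
open scoped commutatorElement IsMulCommutative

/-- A central extension of `G` in which two elements with commuting images do not commute shows that
the relation module is not flabby. -/
theorem not_isFlabby_of_centralExtension {F G E ι : Type} [Group F] [Group G] [Finite G] [Finite ι]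
    [Group E] (s : FreeGroupBasis ι F) (ε : F →* G) (hε : Function.Surjective ε) (π : E →* G)
    (hπ : Function.Surjective π) (hc : π.ker ≤ Subgroup.center E) (a b : E) (hab : ¬ Commute a b)
    (h : Commute (π a) (π b)) : ¬ IsFlabby (relationModule ε hε) := by
  have := Fintype.ofFinite G
  obtain ⟨σ, hσ⟩ := hπ.hasRightInverse
  let l : F →* E := s.lift fun i => σ (ε (s i))
  have hl : ∀ x, π (l x) = ε x := fun x => by
    have : π.comp l = ε := s.ext_hom _ _ fun i => by simp [l, hσ _]
    exact DFunLike.congr_fun this x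
  have hl' : ∀ r : ε.ker, l r ∈ Subgroup.center E := fun r =>
    hc (by rw [MonoidHom.mem_ker, hl]; exact r.2)
  obtain ⟨x, hx⟩ := hε (π a)
  obtain ⟨y, hy⟩ := hε (π b)
  have hxy : ⁅x, y⁆ ∈ ε.ker := by
    rw [MonoidHom.mem_ker, map_commutatorElement, hx, hy]
    exact commutatorElement_eq_one_iff_commute.2 h
  let χ : Additive (Abelianization ε.ker) →+ Additive (Subgroup.center E) :=
    liftRel (A := Additive (Subgroup.center E)) ε
      (fun r => Additive.ofMul (⟨l r, hl' r⟩ : Subgroup.center E)) fun r r' =>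
        congrArg Additive.ofMul (Subtype.ext (map_mul l (r : F) r'))
  refine not_isFlabby_of_functional (relationModule ε hε) χ (fun g m => ?_)
    (relClass ε ⟨⁅x, y⁆, hxy⟩) (fun h0 => hab ?_) (norm_commutator s ε hε x y hxy)
  · obtain ⟨f, rfl⟩ := hε g
    obtain ⟨r, rfl⟩ := relClass_surjective ε m
    change χ (rep ε hε (ε f) (relClass ε r)) = χ (relClass ε r)
    rw [rep_relClass, liftRel_relClass, liftRel_relClass]
    congr 1
    ext
    simp only [MulAut.conjNormal_apply, map_mul, map_inv]
    rw [Subgroup.mem_center_iff.1 (hl' r), mul_inv_cancel_right]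
  · have h1 : ⁅l x, l y⁆ = 1 := by
      rw [← map_commutatorElement]
      exact congrArg Subtype.val (Additive.ofMul.injective h0)
    have hz : ∀ u v : E, π u = π v → u⁻¹ * v ∈ Subgroup.center E := fun u v huv =>
      hc (by rw [MonoidHom.mem_ker, map_mul, map_inv, huv, inv_mul_cancel])
    have hzx := Subgroup.mem_center_iff.1 (hz (l x) a (by rw [hl, hx]))
    have hzy := Subgroup.mem_center_iff.1 (hz (l y) b (by rw [hl, hy]))
    have h2 : Commute (l x) (l y) := commutatorElement_eq_one_iff_commute.1 h1
    have h3 : Commute (l x * ((l x)⁻¹ * a)) (l y * ((l y)⁻¹ * b)) :=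
      Commute.mul_left (Commute.mul_right h2 (hzy (l x)))
        (Commute.symm (hzx _))
    simpa using h3

end RelationModule

namespace DihedralGroup

/-- The reduction map between dihedral groups. -/
def castHom {m n : ℕ} (h : n ∣ m) : DihedralGroup m →* DihedralGroup n where
  toFun
    | r i => r (ZMod.castHom h (ZMod n) i)
    | sr i => sr (ZMod.castHom h (ZMod n) i)
  map_one' := congrArg r (map_zero _)
  map_mul' := by
    rintro (i | i) (j | j) <;> simp only [r_mul_r, r_mul_sr, sr_mul_r, sr_mul_sr, map_add, map_sub]

theorem castHom_r {m n : ℕ} (h : n ∣ m) (i : ZMod m) :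
    castHom h (r i) = r (ZMod.castHom h (ZMod n) i) := rfl

theorem castHom_sr {m n : ℕ} (h : n ∣ m) (i : ZMod m) :
    castHom h (sr i) = sr (ZMod.castHom h (ZMod n) i) := rfl

theorem castHom_surjective {m n : ℕ} (h : n ∣ m) : Function.Surjective (castHom h) := by
  rintro (i | i) <;> obtain ⟨j, rfl⟩ := ZMod.castHom_surjective h i
  exacts [⟨r j, rfl⟩, ⟨sr j, rfl⟩]

theorem ker_castHom_le_center (n : ℕ) :
    (castHom (Dvd.intro_left 2 rfl : n ∣ 2 * n)).ker ≤ Subgroup.center (DihedralGroup (2 * n)) := by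
  rintro (i | i) hi <;> rw [MonoidHom.mem_ker, one_def] at hi
  · rw [castHom_r, r.injEq] at hi
    have h2 : i + i = 0 := by
      obtain ⟨k, rfl⟩ := ZMod.intCast_surjective i
      rw [map_intCast, ZMod.intCast_zmod_eq_zero_iff_dvd _ _] at hi
      rw [← Int.cast_add, ZMod.intCast_zmod_eq_zero_iff_dvd _ _]
      obtain ⟨c, rfl⟩ := hi
      exact ⟨c, by push_cast; ring⟩
    rw [Subgroup.mem_center_iff]
    rintro (j | j)
    · rw [r_mul_r, r_mul_r, add_comm]
    · rw [sr_mul_r, r_mul_sr, sub_eq_add_neg, neg_eq_of_add_eq_zero_left h2]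
  · rw [castHom_sr] at hi
    cases hi

end DihedralGroup

theorem lemma4p4 (n : ℕ) [NeZero n] (hn : 2 ≤ n) {F : Type} [Group F] {d : ℕ}
    (s : FreeGroupBasis (Fin d) F) (ε : F →* DihedralGroup n) (hε : Function.Surjective ε) :
    GLattice.IsLattice (relationModule ε hε) ∧
      (Odd n → GLattice.IsInvertible (relationModule ε hε)) ∧
      (Even n → GLattice.IsCoflabby (relationModule ε hε) ∧
        ¬ GLattice.IsFlabby (relationModule ε hε)) := by
  refine ⟨RelationModule.isLattice s ε hε, fun hodd => ?_, fun heven =>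
    ⟨RelationModule.isCoflabby s ε hε, ?_⟩⟩
  · have hindex : ∀ a : DihedralGroup n, orderOf a * (Subgroup.zpowers a).index = 2 * n := fun a => by
      rw [← Nat.card_zpowers, Subgroup.card_mul_index, DihedralGroup.nat_card]
    have h1 := hindex (DihedralGroup.r 1)
    have h2 := hindex (DihedralGroup.sr 0)
    rw [DihedralGroup.orderOf_r_one, mul_comm 2] at h1
    rw [DihedralGroup.orderOf_sr] at h2
    refine GLattice.isInvertible_of_isCoprime
      (RelationModule.hasDualSystem_index_zpowers s ε hε (DihedralGroup.r 1))
      (RelationModule.hasDualSystem_index_zpowers s ε hε (DihedralGroup.sr 0)) ?_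
    rw [Nat.eq_of_mul_eq_mul_left (NeZero.pos n) h1, Nat.eq_of_mul_eq_mul_left two_pos h2]
    exact Nat.isCoprime_iff_coprime.2 (Nat.coprime_two_left.2 hodd)
  · obtain ⟨k, rfl⟩ := heven
    refine RelationModule.not_isFlabby_of_centralExtension s ε hε _
      (DihedralGroup.castHom_surjective _) (DihedralGroup.ker_castHom_le_center _)
      (DihedralGroup.r k) (DihedralGroup.sr 0) (fun h => ?_) ?_
    · have h1 : (0 : ZMod (2 * (k + k))) - k = 0 + k := DihedralGroup.sr.inj h.eq
      rw [zero_sub, zero_add, neg_eq_iff_add_eq_zero, ← Nat.cast_add,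
        ZMod.natCast_eq_zero_iff] at h1
      exact absurd (Nat.le_of_dvd (by omega) h1) (by omega)
    · have h1 : (0 : ZMod (k + k)) - k = 0 + k := by
        rw [zero_sub, zero_add, neg_eq_iff_add_eq_zero, ← Nat.cast_add, ZMod.natCast_self]
      rw [DihedralGroup.castHom_r, DihedralGroup.castHom_sr, map_natCast, map_zero]
      exact congrArg DihedralGroup.sr h1
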